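/- Let $\mathcal Z$ be a complex Hilbert space, let $A:D(A)\subset\mathcal Z\to\mathcal Z$ be a densely defined skew-adjoint operator ($A^*=-A$, including equality of domains), and let $B:\mathbb C\to\mathcal Z$, $Bu=bu$ with $b\in\mathcal Z\setminus\{0\}$. Assume that $\sigma(A)$ is nonempty, has no finite accumulation point, and consists of eigenvalues of finite algebraic multiplicity. Consider the system $\Sigma(A,B,B^*)$. Its \emph{invariant zeros} are the $\lambda\in\mathbb C$ for which there are $x\in D(A)\setminus\{0\}$ and $u\in\mathbb C$ with $(\lambda I-A)x-Bu=0$ and $B^*x=0$; its \emph{transmission zeros} are the $\lambda\in\rho(A)$ with $G(\lambda)=B^*(\lambda I-A)^{-1}B=0$. Assume that $\Sigma(A,B,B^*)$ is \emph{minimal}, i.e. no invariant zero belongs to $\sigma(A)$. A \emph{branch of the root locus} is a continuous curve $f:[0,\infty)\to\mathbb C$ with $f(0)\in\sigma(A)$ and $f(k)\in\sigma(A-kBB^*)$ for every $k\ge 0$. Then: 1. All eigenvalues of $A$, all invariant zeros and all transmission zeros lie on the imaginary axis. The invariant zeros interlace the eigenvalues of $A$ on the imaginary axis, and so do the transmission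 zeros. That is, for each of these two sets of zeros: no zero is an eigenvalue of $A$; every zero lies strictly between two eigenvalues of $A$; strictly between any two consecutive eigenvalues of $A$ there is exactly one zero; and strictly between any two consecutive zeros there is exactly one eigenvalue of $A$. Moreover, every eigenvalue of $A$ has algebraic multiplicity one. 2. Every branch $f$ of the root locus lies in the closed left half-plane: $\operatorname{Re} f(k)\le 0$ for all $k\ge 0$. More precisely, if $k>0$ and $\lambda\in\sigma(A-kBB^*)$, then $\operatorname{Re}\lambda<0$. -/

import Mathlib

open scoped InnerProductSpace LinearPMap

noncomputable section

namespace RootLocus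

section Operators

variable {Z : Type*} [NormedAddCommGroup Z] [InnerProductSpace ℂ Z]

/-- The operator `s I - A`, defined on `D(A)`. -/
def shift (A : Z →ₗ.[ℂ] Z) (s : ℂ) : A.domain →ₗ[ℂ] Z :=
  s • A.domain.subtype - A.toFun

/-- `R` is the bounded, everywhere defined, two-sided inverse of `s I - A : D(A) → Z`. -/
def IsResolventAt (A : Z →ₗ.[ℂ] Z) (s : ℂ) (R : Z →L[ℂ] Z) : Prop :=
  (∀ z : Z, ∃ h : R z ∈ A.domain, shift A s ⟨R z, h⟩ = z) ∧
    ∀ x : A.domain, R (shift A s x) = x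

/-- The resolvent set `ρ(A)` of a (possibly unbounded) operator. -/
def resolventSet (A : Z →ₗ.[ℂ] Z) : Set ℂ :=
  {s | ∃ R : Z →L[ℂ] Z, IsResolventAt A s R}

/-- The spectrum `σ(A)` of a (possibly unbounded) operator. -/
def spectrum (A : Z →ₗ.[ℂ] Z) : Set ℂ := (resolventSet A)ᶜ

open Classical in
/-- The resolvent `(s I - A)⁻¹`, with value `0` outside the resolvent set. -/
def resolvent (A : Z →ₗ.[ℂ] Z) (s : ℂ) : Z →L[ℂ] Z :=
  if h : ∃ R : Z →L[ℂ] Z, IsResolventAt A s R then h.choose else 0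

/-- The set of eigenvalues of `A`. -/
def eigenvalues (A : Z →ₗ.[ℂ] Z) : Set ℂ :=
  {s | ∃ x : A.domain, x ≠ 0 ∧ A x = s • (x : Z)}

/-- The kernel of `(s I - A) ^ n`, on its natural domain. -/
def kerPow (A : Z →ₗ.[ℂ] Z) (s : ℂ) : ℕ → Submodule ℂ Z
  | 0 => ⊥
  | n + 1 => ((kerPow A s n).comap (shift A s)).map A.domain.subtype

/-- The generalized eigenspace of `A` at `s`, the union of the increasing family
`ker (s I - A) ^ n`; its dimension is the algebraic multiplicity of `s`. -/
def genEigenspace (A : Z →ₗ.[ℂ] Z) (s : ℂ) : Submodule ℂ Z := ⨆ n, kerPow A s n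

/-- `σ(A)` is nonempty and consists of eigenvalues of finite algebraic multiplicity,
with no finite accumulation point. -/
structure HasDiscreteSpectrum (A : Z →ₗ.[ℂ] Z) : Prop where
  nonempty : (spectrum A).Nonempty
  isEigenvalue : ∀ s ∈ spectrum A, s ∈ eigenvalues A
  finiteMultiplicity : ∀ s ∈ spectrum A, FiniteDimensional ℂ (genEigenspace A s)
  noAccumulation : ∀ z : ℂ, ¬ AccPt z (Filter.principal (spectrum A))

/-- `A` is densely defined and `A* = -A`, including equality of the domains. -/
def IsSkewAdjoint [CompleteSpace Z] (A : Z →ₗ.[ℂ] Z) : Prop :=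
  Dense (A.domain : Set Z) ∧ A† = -A

end Operators

section Systems

variable {Z : Type*} [NormedAddCommGroup Z] [InnerProductSpace ℂ Z]

/-- The transfer function `G(s) = C (s I - A)⁻¹ B` of `Σ(A, B, C)`, for `s ∈ ρ(A)`. -/
def transferFunction (A : Z →ₗ.[ℂ] Z) (B : ℂ →L[ℂ] Z) (C : Z →L[ℂ] ℂ) (s : ℂ) : ℂ :=
  C (resolvent A s (B 1))

/-- The transmission zeros of `Σ(A, B, C)`. -/
def transmissionZeros (A : Z →ₗ.[ℂ] Z) (B : ℂ →L[ℂ] Z) (C : Z →L[ℂ] ℂ) : Set ℂ :=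
  {s | s ∈ resolventSet A ∧ transferFunction A B C s = 0}

/-- The invariant zeros of `Σ(A, B, C)`. -/
def invariantZeros (A : Z →ₗ.[ℂ] Z) (B : ℂ →L[ℂ] Z) (C : Z →L[ℂ] ℂ) : Set ℂ :=
  {s | ∃ (x : A.domain) (u : ℂ), x ≠ 0 ∧ s • (x : Z) - A x - B u = 0 ∧ C (x : Z) = 0}

/-- `Σ(A, B, C)` is minimal: no invariant zero lies in the spectrum of `A`. -/
def IsMinimal (A : Z →ₗ.[ℂ] Z) (B : ℂ →L[ℂ] Z) (C : Z →L[ℂ] ℂ) : Prop :=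
  invariantZeros A B C ∩ spectrum A = ∅

/-- The closed-loop operator `A - k B C`, with domain `D(A)`. -/
def closedLoop (A : Z →ₗ.[ℂ] Z) (B : ℂ →L[ℂ] Z) (C : Z →L[ℂ] ℂ) (k : ℝ) : Z →ₗ.[ℂ] Z where
  domain := A.domain
  toFun := A.toFun - (((k : ℂ) • (B ∘L C) : Z →L[ℂ] Z) : Z →ₗ[ℂ] Z) ∘ₗ A.domain.subtype

/-- `f`, restricted to `[0, ∞)`, is a branch of the root locus of `Σ(A, B, C)`: a continuous
curve starting in `σ(A)`, with `f k ∈ σ(A - k B C)` for all `k ≥ 0`. -/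
structure IsRootLocusBranch (A : Z →ₗ.[ℂ] Z) (B : ℂ →L[ℂ] Z) (C : Z →L[ℂ] ℂ)
    (f : ℝ → ℂ) : Prop where
  continuousOn : ContinuousOn f (Set.Ici 0)
  start : f 0 ∈ spectrum A
  mem : ∀ k : ℝ, 0 ≤ k → f k ∈ spectrum (closedLoop A B C k)

end Systems

/-- `a < b` are consecutive elements of the set `S` of real numbers. -/
def Consecutive (S : Set ℝ) (a b : ℝ) : Prop :=
  a ∈ S ∧ b ∈ S ∧ a < b ∧ ∀ c ∈ S, ¬ (a < c ∧ c < b)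

/-- The set `M` strictly interlaces the (locally finite) set `L` of real numbers. -/
structure Interlaces (M L : Set ℝ) : Prop where
  disjoint : Disjoint M L
  between : ∀ μ ∈ M, ∃ a ∈ L, ∃ b ∈ L, a < μ ∧ μ < b
  unique_left : ∀ a b : ℝ, Consecutive L a b → ∃! μ : ℝ, μ ∈ M ∧ a < μ ∧ μ < b
  unique_right : ∀ a b : ℝ, Consecutive M a b → ∃! l : ℝ, l ∈ L ∧ a < l ∧ l < b

/-- The sets `M` and `L` lie on the imaginary axis, and `M` interlaces `L` there. -/
structure InterlacesOnImaginaryAxis (M L : Set ℂ) : Prop where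
  re_left : ∀ s ∈ M, s.re = 0
  re_right : ∀ s ∈ L, s.re = 0
  interlaces : Interlaces (Complex.im '' M) (Complex.im '' L)

end RootLocus

end

/-! Write `A = iH` with `H` symmetric. Discreteness puts `σ(A)` on the imaginary axis, and for `iω ∈
ρ(A)` the operator `T = (ω - H)⁻¹` is bounded and self-adjoint. Minimality says exactly what is
needed of `b = B 1`: no eigenvector is orthogonal to it.

Zeros: `Re G(s) = Re s ‖(s - A)⁻¹ b‖²` forces transmission zeros onto the axis, where they are the
zeros of the real gain `g(ω) = ⟨b, T b⟩`. Since `g' = -‖T b‖² < 0`, `g` is strictly decreasing on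
each spectral gap. At the ends of a bounded gap the poles make it positive, respectively negative,
so it has one zero there (`existsUnique_realGain_zero`). A zero outside all eigenvalues would make
`T` semidefinite with `⟨b, T b⟩ = 0`, hence `T b = 0`, which is impossible
(`exists_spectrum_lt_lt`). Off `σ(A)`, invariant and transmission zeros agree.

Multiplicity: two independent eigenvectors for the same eigenvalue would have a nonzero combination
orthogonal to `b`, and skew-symmetry excludes Jordan chains.

Closed loop: for `Re s ≥ 0` and `k > 0`, an energy identity makes `s - A + kBB*` injective.
Surjectivity is a rank-one solve on `ρ(A)`; on `σ(A)` it rests on `Z = ker (s - A) + ran (s - A)`,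
obtained from the functional calculus of `T`. The open mapping theorem then bounds the inverse. -/

namespace RootLocus

/-! ### Resolvent calculus for unbounded operators. -/

section Resolvents

variable {Z : Type*} [NormedAddCommGroup Z] [InnerProductSpace ℂ Z] {A : Z →ₗ.[ℂ] Z}

theorem shift_apply (s : ℂ) (x : A.domain) : shift A s x = s • (x : Z) - A x := rfl

theorem shift_closedLoop_apply (B : ℂ →L[ℂ] Z) (C : Z →L[ℂ] ℂ) (k : ℝ) (s : ℂ) (x : A.domain) :
    shift (closedLoop A B C k) s x = shift A s x + ((k : ℂ) * C (x : Z)) • B 1 := by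
  have : B (C (x : Z)) = C (x : Z) • B 1 := by rw [← map_smul, smul_eq_mul, mul_one]
  change s • (x : Z) - (A x - (k : ℂ) • B (C (x : Z))) = s • (x : Z) - A x + _
  rw [this, mul_smul]
  abel

theorem isResolventAt_resolvent {s : ℂ} (hs : s ∈ resolventSet A) :
    IsResolventAt A s (resolvent A s) := by
  have hs' : ∃ R : Z →L[ℂ] Z, IsResolventAt A s R := hs
  unfold resolvent
  rw [dif_pos hs']
  exact hs'.choose_spec

namespace IsResolventAt

variable {s t : ℂ} {R S : Z →L[ℂ] Z}

theorem mem_domain (h : IsResolventAt A s R) (z : Z) : R z ∈ A.domain := (h.1 z).1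

theorem shift_apply_self (h : IsResolventAt A s R) (z : Z) :
    shift A s ⟨R z, h.mem_domain z⟩ = z := (h.1 z).2

theorem map_eq (h : IsResolventAt A s R) (z : Z) :
    A ⟨R z, h.mem_domain z⟩ = s • R z - z := by
  have := h.shift_apply_self z
  rw [shift_apply] at this
  rw [eq_sub_iff_add_eq, ← eq_sub_iff_add_eq']
  exact this.symm

theorem shift_eq (h : IsResolventAt A s R) (t : ℂ) (z : Z) :
    shift A t ⟨R z, h.mem_domain z⟩ = z + (t - s) • R z := by
  rw [shift_apply, h.map_eq, sub_smul]
  simp only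
  abel

theorem eq_of_shift (h : IsResolventAt A s R) (x : A.domain) {z : Z} (hx : shift A s x = z) :
    R z = x := hx ▸ h.2 x

theorem unique (h : IsResolventAt A s R) (h' : IsResolventAt A s S) : R = S := by
  ext z
  exact h.eq_of_shift ⟨S z, h'.mem_domain z⟩ (h'.shift_apply_self z)

theorem mem (h : IsResolventAt A s R) : s ∈ resolventSet A := ⟨R, h⟩

theorem resolvent_eq (h : IsResolventAt A s R) : resolvent A s = R :=
  (isResolventAt_resolvent h.mem).unique h

theorem apply_ne_zero (h : IsResolventAt A s R) {z : Z} (hz : z ≠ 0) : R z ≠ 0 := by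
  intro h0
  have h1 := h.shift_apply_self z
  have h2 : (⟨R z, h.mem_domain z⟩ : A.domain) = 0 := Subtype.ext h0
  rw [h2, map_zero] at h1
  exact hz h1.symm

/-- The resolvent identity. -/
theorem sub_eq (h : IsResolventAt A s R) (h' : IsResolventAt A t S) :
    R = S + (t - s) • (R * S) := by
  ext z
  have h1 := h.2 ⟨S z, h'.mem_domain z⟩
  rw [h'.shift_eq, map_add, map_smul] at h1
  change R z = S z + (t - s) • R (S z)
  have h2 : S z = R z + (s - t) • R (S z) := h1.symm
  nth_rw 1 [h2]
  rw [sub_smul, sub_smul]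
  abel

theorem apply_of_mem_ker (h : IsResolventAt A s R) {e : A.domain} (he : A e = t • (e : Z))
    (hst : s ≠ t) : R e = (s - t)⁻¹ • (e : Z) := by
  have h1 := h.2 e
  rw [shift_apply, he, ← sub_smul, map_smul] at h1
  rw [← h1, smul_smul, inv_mul_cancel₀ (sub_ne_zero.mpr hst), one_smul, h1]

/-- Resolvents at neighbouring points, from the Neumann factor `1 + (t - s) R`. -/
theorem of_isUnit (h : IsResolventAt A s R) (hu : IsUnit (1 + (t - s) • R)) :
    IsResolventAt A t (R * Ring.inverse (1 + (t - s) • R)) := by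
  obtain ⟨u, hu⟩ := hu
  rw [← hu, Ring.inverse_unit]
  constructor
  · intro z
    refine ⟨h.mem_domain _, ?_⟩
    have := h.shift_eq t ((↑u⁻¹ : Z →L[ℂ] Z) z)
    refine this.trans ?_
    have h2 := congrArg (fun F : Z →L[ℂ] Z => F z) u.mul_inv
    rw [hu] at h2
    simpa using h2
  · intro x
    have h1 : shift A t x = (u : Z →L[ℂ] Z) (shift A s x) := by
      have h2 : (1 + (t - s) • R : Z →L[ℂ] Z) (shift A s x)
          = shift A s x + (t - s) • R (shift A s x) := rfl
      rw [hu, h2, h.2 x, shift_apply, shift_apply, sub_smul]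
      abel
    have h2 := congrArg (fun F : Z →L[ℂ] Z => F (shift A s x)) u.inv_mul
    simp only [mul_apply_eq_comp, one_apply_eq_self] at h2
    rw [h1, mul_apply_eq_comp, h2, h.2]

end IsResolventAt

variable [CompleteSpace Z]

/-- Near `s` the resolvent is `R (1 + (t - s) R)⁻¹`, so the derivative of inversion at `1` gives the
result. -/
theorem IsResolventAt.hasDerivAt {s : ℂ} {R : Z →L[ℂ] Z} (h : IsResolventAt A s R) :
    HasDerivAt (resolvent A) (-(R * R)) s := by
  have hF : HasDerivAt (fun t : ℂ => 1 + (t - s) • R) R s := by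
    simpa using (((hasDerivAt_id s).sub_const s).smul_const R).const_add 1
  have h1 : (1 : Z →L[ℂ] Z) + (s - s) • R = ((1 : (Z →L[ℂ] Z)ˣ) : Z →L[ℂ] Z) := by simp
  have hu : ∀ᶠ t in nhds s, IsUnit (1 + (t - s) • R) := by
    refine hF.continuousAt.eventually (p := IsUnit) ?_
    exact Units.isOpen.mem_nhds (by simp)
  have hI := hasFDerivAt_ringInverse (𝕜 := ℂ) (1 : (Z →L[ℂ] Z)ˣ)
  rw [← h1] at hI
  have hD := (hI.comp_hasDerivAt s hF).const_mul R
  have hD' : HasDerivAt (fun t : ℂ => R * Ring.inverse (1 + (t - s) • R)) (-(R * R)) s := by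
    simpa using hD
  refine hD'.congr_of_eventuallyEq ?_
  filter_upwards [hu] with t ht
  exact (h.of_isUnit ht).resolvent_eq

end Resolvents

/-! ### Skew-symmetry and the energy identity. -/

section Skew

variable {Z : Type*} [NormedAddCommGroup Z] [InnerProductSpace ℂ Z] {A : Z →ₗ.[ℂ] Z}

/-- `⟨A x, y⟩ = -⟨x, A y⟩` on the domain of `A`. -/
def IsSkewSymmetric (A : Z →ₗ.[ℂ] Z) : Prop :=
  ∀ x y : A.domain, ⟪A x, (y : Z)⟫_ℂ = -⟪(x : Z), A y⟫_ℂ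

theorem IsSkewAdjoint.isSkewSymmetric [CompleteSpace Z] (h : IsSkewAdjoint A) :
    IsSkewSymmetric A := by
  have h1 := LinearPMap.adjoint_isFormalAdjoint h.1
  rw [h.2] at h1
  intro x y
  have h2 : ⟪-(A x), (y : Z)⟫_ℂ = ⟪(x : Z), A y⟫_ℂ := h1 x y
  rw [inner_neg_left] at h2
  rw [← h2, neg_neg]

namespace IsSkewSymmetric

theorem re_inner_self (h : IsSkewSymmetric A) (x : A.domain) : (⟪(x : Z), A x⟫_ℂ).re = 0 := by
  have h1 := congrArg Complex.re (h x x)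
  rw [← inner_conj_symm, Complex.conj_re, Complex.neg_re] at h1
  linarith

/-- The term `⟨x, A x⟩` is purely imaginary. This identity yields the imaginary eigenvalues, the
sign of `Re G` and closed-loop injectivity. -/
theorem re_inner_shift (h : IsSkewSymmetric A) (s : ℂ) (x : A.domain) :
    (⟪(x : Z), shift A s x⟫_ℂ).re = s.re * ‖(x : Z)‖ ^ 2 := by
  rw [shift_apply, inner_sub_right, Complex.sub_re, h.re_inner_self, inner_smul_right,
    inner_self_eq_norm_sq_to_K, sub_zero]
  exact (congrArg (fun c : ℂ => (s * c).re) (Complex.ofReal_pow ‖(x : Z)‖ 2).symm).trans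
    (Complex.re_mul_ofReal _ _)

theorem re_eq_zero (h : IsSkewSymmetric A) {s : ℂ} (hs : s ∈ eigenvalues A) : s.re = 0 := by
  obtain ⟨x, hx, hAx⟩ := hs
  have h1 := h.re_inner_shift s x
  rw [shift_apply, hAx, sub_self, inner_zero_right, Complex.zero_re] at h1
  have hx' : ‖(x : Z)‖ ≠ 0 := by simpa using hx
  simpa [hx'] using h1.symm

/-- The range of `s - A` is orthogonal to its kernel when `s` is imaginary. -/
theorem inner_shift_eq_zero (h : IsSkewSymmetric A) {s : ℂ} (hs : s.re = 0) (x : A.domain)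
    {e : A.domain} (he : A e = s • (e : Z)) : ⟪(e : Z), shift A s x⟫_ℂ = 0 := by
  have hc : (starRingEnd ℂ) s = -s := by
    apply Complex.ext <;> simp [hs]
  have h1 := h e x
  rw [he, inner_smul_left, hc] at h1
  rw [shift_apply, inner_sub_right, inner_smul_right]
  linear_combination -h1

theorem inner_resolvent (h : IsSkewSymmetric A) {s : ℂ} (hs : s.re = 0) {R : Z →L[ℂ] Z}
    (hR : IsResolventAt A s R) (z w : Z) : ⟪R z, w⟫_ℂ = -⟪z, R w⟫_ℂ := by
  have hc : (starRingEnd ℂ) s = -s := by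
    apply Complex.ext <;> simp [hs]
  have h1 := h ⟨R z, hR.mem_domain z⟩ ⟨R w, hR.mem_domain w⟩
  rw [hR.map_eq, hR.map_eq] at h1
  simp only [inner_sub_left, inner_sub_right, inner_smul_left, inner_smul_right, hc] at h1
  linear_combination -h1

end IsSkewSymmetric

theorem mem_spectrum_of_mem_eigenvalues {s : ℂ} (hs : s ∈ eigenvalues A) : s ∈ spectrum A := by
  obtain ⟨x, hx, hAx⟩ := hs
  rintro ⟨R, hR⟩
  have h1 := hR.2 x
  rw [shift_apply, hAx, sub_self, map_zero] at h1
  exact hx (Subtype.ext h1.symm)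

theorem HasDiscreteSpectrum.eigenvalues_eq (h : HasDiscreteSpectrum A) :
    eigenvalues A = spectrum A :=
  Set.Subset.antisymm (fun _ hs => mem_spectrum_of_mem_eigenvalues hs) h.isEigenvalue

end Skew

/-! ### The self-adjoint resolvent of `H = -iA`. -/

section SelfAdjoint

variable {Z : Type*} [NormedAddCommGroup Z] [InnerProductSpace ℂ Z]
  {A : Z →ₗ.[ℂ] Z}

/-- The resolvent `(ω - H)⁻¹` of `H = -i A` at the real point `ω`. -/
noncomputable def realResolvent (A : Z →ₗ.[ℂ] Z) (ω : ℝ) : Z →L[ℂ] Z :=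
  Complex.I • resolvent A (ω * Complex.I)

theorem IsSkewSymmetric.isSelfAdjoint [CompleteSpace Z] (h : IsSkewSymmetric A) {ω : ℝ}
    (hω : (ω * Complex.I : ℂ) ∈ resolventSet A) : IsSelfAdjoint (realResolvent A ω) := by
  rw [ContinuousLinearMap.isSelfAdjoint_iff_isSymmetric]
  intro z w
  have h1 := h.inner_resolvent (by simp) (isResolventAt_resolvent hω) z w
  simp only [realResolvent, ContinuousLinearMap.coe_coe, smul_apply,
    inner_smul_left, inner_smul_right, h1, Complex.conj_I]
  ring

theorem realResolvent_sub {ω τ : ℝ} (hω : (ω * Complex.I : ℂ) ∈ resolventSet A)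
    (hτ : (τ * Complex.I : ℂ) ∈ resolventSet A) :
    realResolvent A ω =
      realResolvent A τ + ((τ : ℂ) - ω) • (realResolvent A ω * realResolvent A τ) := by
  have h1 := (isResolventAt_resolvent hω).sub_eq (isResolventAt_resolvent hτ)
  unfold realResolvent
  conv_lhs => rw [h1]
  simp only [smul_add, smul_mul_assoc, mul_smul_comm, smul_smul]
  congr 2
  ring

/-- Nonzero spectral values of `(ω - H)⁻¹` come from spectral values of `A`. -/
theorem mem_spectrum_of_mem_spectrum_realResolvent {ω ν : ℝ}
    (hω : (ω * Complex.I : ℂ) ∈ resolventSet A) (hν : ν ∈ _root_.spectrum ℝ (realResolvent A ω))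
    (h0 : ν ≠ 0) : (((ω - ν⁻¹ : ℝ) : ℂ) * Complex.I) ∈ spectrum A := by
  by_contra hcon
  have hτ : (((ω - ν⁻¹ : ℝ) : ℂ) * Complex.I) ∈ resolventSet A := by
    simpa [spectrum] using hcon
  refine hν ?_
  have e1 := realResolvent_sub hω hτ
  have e2 := realResolvent_sub hτ hω
  set T := realResolvent A ω
  set S := realResolvent A (ω - ν⁻¹)
  have hν' : (ν : ℂ) ≠ 0 := by exact_mod_cast h0
  have c1 : (((ω - ν⁻¹ : ℝ) : ℂ) - ω) = -(ν : ℂ)⁻¹ := by push_cast; ring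
  have c2 : ((ω : ℂ) - ((ω - ν⁻¹ : ℝ) : ℂ)) = (ν : ℂ)⁻¹ := by push_cast; ring
  rw [c1] at e1
  rw [c2] at e2
  have ha : algebraMap ℝ (Z →L[ℂ] Z) ν = (ν : ℂ) • 1 := by
    rw [Algebra.algebraMap_eq_smul_one]; rfl
  have e1' : (ν : ℂ)⁻¹ • (T * S) = S - T := by
    rw [eq_sub_iff_add_eq']; nth_rw 1 [e1]; rw [neg_smul]; abel
  have e2' : (ν : ℂ)⁻¹ • (S * T) = S - T := by
    rw [eq_sub_iff_add_eq']; exact e2.symm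
  have e1'' : T * S = (ν : ℂ) • (S - T) := by
    rw [← e1', smul_smul, mul_inv_cancel₀ hν', one_smul]
  have e2'' : S * T = (ν : ℂ) • (S - T) := by
    rw [← e2', smul_smul, mul_inv_cancel₀ hν', one_smul]
  rw [_root_.spectrum.mem_resolventSet_iff, ha]
  -- With `S` the resolvent at `ω - ν⁻¹`, the resolvent identity in both orders makes this a
  -- two-sided inverse of `ν - T`.
  refine isUnit_iff_exists.mpr ⟨(ν : ℂ)⁻¹ • (1 + (ν : ℂ)⁻¹ • S), ?_, ?_⟩
  · simp only [sub_mul, mul_add, smul_mul_assoc, mul_smul_comm, mul_one, one_mul, smul_add,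
      smul_sub, smul_smul, e1'']
    field_simp
    module
  · simp only [mul_sub, add_mul, smul_mul_assoc, mul_smul_comm, mul_one, one_mul, smul_add,
      smul_sub, smul_smul, e2'']
    field_simp
    module

end SelfAdjoint

/-! ### Spectral bounds for quadratic forms. -/

section QuadraticForm

variable {Z : Type*} [NormedAddCommGroup Z] [InnerProductSpace ℂ Z]

theorem re_inner_algebraMap (m : ℝ) (v : Z) :
    (⟪v, (algebraMap ℝ (Z →L[ℂ] Z) m) v⟫_ℂ).re = m * ‖v‖ ^ 2 := by
  have h1 : (algebraMap ℝ (Z →L[ℂ] Z) m) v = (m : ℂ) • v := by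
    rw [Algebra.algebraMap_eq_smul_one]; rfl
  rw [h1, inner_smul_right, inner_self_eq_norm_sq_to_K, Complex.re_ofReal_mul]
  exact congrArg (m * ·) ((congrArg Complex.re (Complex.ofReal_pow ‖v‖ 2).symm).trans
    (Complex.ofReal_re _))

theorem re_inner_le_of_le {S T : Z →L[ℂ] Z} (h : S ≤ T) (v : Z) :
    (⟪v, S v⟫_ℂ).re ≤ (⟪v, T v⟫_ℂ).re := by
  have h1 := ((ContinuousLinearMap.le_def S T).mp h).re_inner_nonneg_right v
  rw [sub_apply, inner_sub_right] at h1
  simpa using h1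

variable [CompleteSpace Z]

theorem le_re_inner_of_le_spectrum {T : Z →L[ℂ] Z} (hT : IsSelfAdjoint T) {m : ℝ}
    (h : ∀ ν ∈ _root_.spectrum ℝ T, m ≤ ν) (v : Z) : m * ‖v‖ ^ 2 ≤ (⟪v, T v⟫_ℂ).re := by
  rw [← re_inner_algebraMap]
  exact re_inner_le_of_le ((algebraMap_le_iff_le_spectrum (a := T) hT).mpr h) v

theorem re_inner_le_of_spectrum_le {T : Z →L[ℂ] Z} (hT : IsSelfAdjoint T) {m : ℝ}
    (h : ∀ ν ∈ _root_.spectrum ℝ T, ν ≤ m) (v : Z) : (⟪v, T v⟫_ℂ).re ≤ m * ‖v‖ ^ 2 := by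
  rw [← re_inner_algebraMap]
  exact re_inner_le_of_le ((le_algebraMap_iff_spectrum_le (a := T) hT).mpr h) v

/-- Factor `T = S* S`; the form at `v` is `‖S v‖²`. -/
theorem apply_eq_zero_of_nonneg {T : Z →L[ℂ] Z} (hT : 0 ≤ T) {v : Z}
    (hv : (⟪v, T v⟫_ℂ).re = 0) : T v = 0 := by
  obtain ⟨S, rfl⟩ := CStarAlgebra.nonneg_iff_eq_star_mul_self.mp hT
  rw [mul_apply_eq_comp, ContinuousLinearMap.star_eq_adjoint,
    ContinuousLinearMap.adjoint_inner_right] at hv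
  have h1 : ‖S v‖ ^ 2 = 0 := by rw [← hv]; exact norm_sq_eq_re_inner (𝕜 := ℂ) _
  have h2 : S v = 0 := by simpa using h1
  rw [mul_apply_eq_comp, h2, map_zero]

theorem apply_eq_zero_of_spectrum_nonneg {T : Z →L[ℂ] Z} (hT : IsSelfAdjoint T)
    (h : ∀ ν ∈ _root_.spectrum ℝ T, 0 ≤ ν) {v : Z} (hv : (⟪v, T v⟫_ℂ).re = 0) : T v = 0 :=
  apply_eq_zero_of_nonneg 
    (by simpa using (algebraMap_le_iff_le_spectrum (a := T) (r := (0 : ℝ)) hT).mpr h) hv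

theorem apply_eq_zero_of_spectrum_nonpos {T : Z →L[ℂ] Z} (hT : IsSelfAdjoint T)
    (h : ∀ ν ∈ _root_.spectrum ℝ T, ν ≤ 0) {v : Z} (hv : (⟪v, T v⟫_ℂ).re = 0) : T v = 0 := by
  have h1 : (-T) v = 0 := by
    refine apply_eq_zero_of_spectrum_nonneg hT.neg (fun ν hν => ?_) ?_
    · rw [← _root_.spectrum.neg_eq, Set.mem_neg] at hν
      have := h _ hν
      linarith
    · simp [hv]
  simpa using h1

/-- Splitting off an eigenvector `e` of `T` from a vector `v` in the quadratic form of `T`. -/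
theorem re_inner_eigenvector_split {T : Z →L[ℂ] Z} (hT : IsSelfAdjoint T) {τ : ℝ} {v e : Z}
    (he : T e = (τ : ℂ) • e) (hve : ⟪e, v - e⟫_ℂ = 0) :
    (⟪v, T v⟫_ℂ).re = (⟪v - e, T (v - e)⟫_ℂ).re + τ * ‖e‖ ^ 2 := by
  have hs := (ContinuousLinearMap.isSelfAdjoint_iff_isSymmetric.mp hT)
  obtain ⟨w, rfl⟩ : ∃ w, v = w + e := ⟨v - e, by abel⟩
  rw [add_sub_cancel_right] at hve ⊢
  have hwe : ⟪w, e⟫_ℂ = 0 := by rw [← inner_conj_symm, hve, map_zero]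
  have h1 : ⟪e, T w⟫_ℂ = 0 := by
    have : ⟪T e, w⟫_ℂ = ⟪e, T w⟫_ℂ := hs e w
    rw [← this, he, inner_smul_left, hve, mul_zero]
  rw [map_add, inner_add_left, inner_add_right, inner_add_right, h1, he, inner_smul_right,
    inner_smul_right, hwe, mul_zero, add_zero, zero_add, Complex.add_re, Complex.re_ofReal_mul]
  have h2 : ‖e‖ ^ 2 = (⟪e, e⟫_ℂ).re := norm_sq_eq_re_inner (𝕜 := ℂ) e
  rw [h2]

end QuadraticForm

/-! ### The real gain on a spectral gap. -/

section Gain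

variable {Z : Type*} [NormedAddCommGroup Z] [InnerProductSpace ℂ Z] {A : Z →ₗ.[ℂ] Z}

/-- The real function `ω ↦ ⟨b, (ω - H)⁻¹ b⟩`, where `H = -i A`. -/
noncomputable def realGain (A : Z →ₗ.[ℂ] Z) (b : Z) (ω : ℝ) : ℝ :=
  (⟪b, realResolvent A ω b⟫_ℂ).re

theorem realResolvent_apply_eigenvector {ω l : ℝ} (hω : (ω * Complex.I : ℂ) ∈ resolventSet A)
    {e : A.domain} (he : A e = (l * Complex.I : ℂ) • (e : Z)) (hl : ω ≠ l) :
    realResolvent A ω e = (((ω - l)⁻¹ : ℝ) : ℂ) • (e : Z) := by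
  have h0 : (ω : ℂ) - l ≠ 0 := by rw [sub_ne_zero]; exact_mod_cast hl
  have h1 : (ω * Complex.I : ℂ) ≠ l * Complex.I := by
    intro h
    exact hl (by exact_mod_cast mul_right_cancel₀ Complex.I_ne_zero h)
  unfold realResolvent
  rw [smul_apply, (isResolventAt_resolvent hω).apply_of_mem_ker he h1, smul_smul]
  congr 1
  rw [← sub_mul]
  push_cast
  field_simp

theorem realResolvent_apply_ne_zero {ω : ℝ} (hω : (ω * Complex.I : ℂ) ∈ resolventSet A)
    {b : Z} (hb : b ≠ 0) : realResolvent A ω b ≠ 0 := by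
  unfold realResolvent
  rw [smul_apply]
  exact smul_ne_zero Complex.I_ne_zero ((isResolventAt_resolvent hω).apply_ne_zero hb)

/-- A nonzero spectral value is `1 / (ω - l)` with `il ∈ σ(A)`, and such an `l` lies outside the gap
`(a, c)`. -/
theorem spectrum_realResolvent_bounds {a c : ℝ}
    (hgap : ∀ ω ∈ Set.Ioo a c, (ω * Complex.I : ℂ) ∈ resolventSet A) {ω ν : ℝ} (hω : ω ∈ Set.Ioo a c)
    (hν : ν ∈ _root_.spectrum ℝ (realResolvent A ω)) : -(c - ω)⁻¹ ≤ ν ∧ ν ≤ (ω - a)⁻¹ := by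
  have ha : 0 < ω - a := sub_pos.mpr hω.1
  have hc : 0 < c - ω := sub_pos.mpr hω.2
  have ha' := inv_pos.mpr ha
  have hc' := inv_pos.mpr hc
  rcases lt_trichotomy ν 0 with h | rfl | h
  · refine ⟨?_, by linarith⟩
    have h1 := mem_spectrum_of_mem_spectrum_realResolvent (hgap ω hω) hν h.ne
    have h2 : ω - ν⁻¹ ∉ Set.Ioo a c := fun hm => h1 (hgap _ hm)
    have h3 : ν⁻¹ < 0 := inv_lt_zero.mpr h
    have h4 : c ≤ ω - ν⁻¹ := not_lt.mp fun hlt => h2 ⟨by linarith, hlt⟩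
    rw [neg_le]
    have h5 := inv_anti₀ hc (by linarith : c - ω ≤ -ν⁻¹)
    rwa [inv_neg, inv_inv] at h5
  · exact ⟨by linarith, by linarith⟩
  · refine ⟨by linarith, ?_⟩
    have h1 := mem_spectrum_of_mem_spectrum_realResolvent (hgap ω hω) hν h.ne'
    have h2 : ω - ν⁻¹ ∉ Set.Ioo a c := fun hm => h1 (hgap _ hm)
    have h3 : 0 < ν⁻¹ := inv_pos.mpr h
    have h4 : ω - ν⁻¹ ≤ a := not_lt.mp fun hlt => h2 ⟨hlt, by linarith⟩
    have h5 := inv_anti₀ ha (by linarith : ω - a ≤ ν⁻¹)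
    rwa [inv_inv] at h5

/-- A pole dominates a bounded term near it: `N / (l - δ) < E / δ` for some small `δ`. -/
theorem exists_pole_dominates {N E l : ℝ} (hN : 0 ≤ N) (hE : 0 < E) (hl : 0 < l) :
    ∃ δ, 0 < δ ∧ δ < l ∧ (l - δ)⁻¹ * N < δ⁻¹ * E := by
  have hd : 0 < N + E + E := by positivity
  -- The target amounts to `δ (N + E) < E l`; the second `E` in the denominator makes it strict.
  have hδ : 0 < E * l / (N + E + E) := by positivity
  have h1 : E * l / (N + E + E) * (N + E) < E * l := by
    rw [div_mul_eq_mul_div, div_lt_iff₀ hd]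
    exact mul_lt_mul_of_pos_left (by linarith) (by positivity)
  refine ⟨_, hδ, ?_, ?_⟩
  · rw [div_lt_iff₀ hd]; nlinarith
  · have hlt : E * l / (N + E + E) < l := by rw [div_lt_iff₀ hd]; nlinarith
    generalize E * l / (N + E + E) = δ at *
    have hp : 0 < l - δ := sub_pos.mpr hlt
    rw [inv_mul_eq_div, inv_mul_eq_div, div_lt_div_iff₀ hp hδ]
    nlinarith

/-- If `b` is not orthogonal to an eigenvector, some eigenvector is a nonzero orthogonal
component of `b`. -/
theorem exists_eigenvector_component {s : ℂ} {b : Z} {x : A.domain} (hx : A x = s • (x : Z))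
    (hb : ⟪b, (x : Z)⟫_ℂ ≠ 0) :
    ∃ e : A.domain, A e = s • (e : Z) ∧ (e : Z) ≠ 0 ∧ ⟪(e : Z), b - e⟫_ℂ = 0 := by
  have hx0 : (x : Z) ≠ 0 := by rintro h; rw [h, inner_zero_right] at hb; exact hb rfl
  have hxx : ⟪(x : Z), (x : Z)⟫_ℂ ≠ 0 := inner_self_ne_zero.mpr hx0
  have hxb : ⟪(x : Z), b⟫_ℂ ≠ 0 := by
    intro h; exact hb (by rw [← inner_conj_symm, h, map_zero])
  refine ⟨(⟪(x : Z), b⟫_ℂ / ⟪(x : Z), (x : Z)⟫_ℂ) • x, ?_, ?_, ?_⟩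
  · rw [LinearPMap.map_smul, hx, smul_comm]; rfl
  · exact smul_ne_zero (div_ne_zero hxb hxx) hx0
  · change ⟪(⟪(x : Z), b⟫_ℂ / ⟪(x : Z), (x : Z)⟫_ℂ) • (x : Z),
      b - (⟪(x : Z), b⟫_ℂ / ⟪(x : Z), (x : Z)⟫_ℂ) • (x : Z)⟫_ℂ = 0
    rw [inner_smul_left, inner_sub_right, inner_smul_right, div_mul_cancel₀ _ hxx, sub_self,
      mul_zero]

variable [CompleteSpace Z]

/-- The resolvent identity gives `T' = -T²`, and self-adjointness turns `⟨b, T² b⟩` into `‖T b‖²`.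
-/
theorem hasDerivAt_realGain (hA : IsSkewSymmetric A) (b : Z) {ω : ℝ}
    (hω : (ω * Complex.I : ℂ) ∈ resolventSet A) :
    HasDerivAt (realGain A b) (-‖realResolvent A ω b‖ ^ 2) ω := by
  have h1 := (isResolventAt_resolvent hω).hasDerivAt
  have h2 : HasDerivAt (fun t : ℝ => (t : ℂ) * Complex.I) Complex.I ω := by
    simpa using (Complex.ofRealCLM.hasDerivAt (x := ω)).mul_const Complex.I
  have h3 := (h1.scomp ω h2).const_smul Complex.I
  let F : (Z →L[ℂ] Z) →L[ℝ] ℝ := Complex.reCLM ∘L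
    ((innerSL ℂ b ∘L ContinuousLinearMap.apply ℂ Z b).restrictScalars ℝ)
  have h4 := F.hasFDerivAt.comp_hasDerivAt ω h3
  have h5 : F (Complex.I • (Complex.I • -(resolvent A (ω * Complex.I) * resolvent A (ω * Complex.I))))
      = -‖realResolvent A ω b‖ ^ 2 := by
    have h6 : (Complex.I • (Complex.I • -(resolvent A (ω * Complex.I) * resolvent A (ω * Complex.I))))
      = -(realResolvent A ω * realResolvent A ω) := by
      simp only [realResolvent, smul_mul_assoc, mul_smul_comm, smul_neg]
    have h7 : ⟪realResolvent A ω b, realResolvent A ω b⟫_ℂ =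
        ⟪b, realResolvent A ω (realResolvent A ω b)⟫_ℂ :=
      (ContinuousLinearMap.isSelfAdjoint_iff_isSymmetric.mp (hA.isSelfAdjoint hω)) b _
    have h8 : ‖realResolvent A ω b‖ ^ 2 = _ := norm_sq_eq_re_inner (𝕜 := ℂ) _
    rw [h6, h8, h7]
    change (⟪b, -(realResolvent A ω (realResolvent A ω b))⟫_ℂ).re = _
    rw [inner_neg_right, Complex.neg_re]
    rfl
  rw [h5] at h4
  exact h4

/-- Split off the component `e` of `b` at the eigenvalue `ia`. It contributes `‖e‖² / (ω - a)`,
while the rest is at least `-‖b - e‖² / (c - ω)`; the pole wins near `a`. -/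
theorem exists_realGain_pos (hA : IsSkewSymmetric A) {b : Z} {a c : ℝ} (hac : a < c)
    (hgap : ∀ ω ∈ Set.Ioo a c, (ω * Complex.I : ℂ) ∈ resolventSet A)
    {x : A.domain} (hx : A x = (a * Complex.I : ℂ) • (x : Z)) (hb : ⟪b, (x : Z)⟫_ℂ ≠ 0) :
    ∃ ω ∈ Set.Ioo a c, 0 < realGain A b ω := by
  obtain ⟨e, he, he0, hbe⟩ := exists_eigenvector_component hx hb
  obtain ⟨δ, hδ, hδl, hlt⟩ := exists_pole_dominates (sq_nonneg ‖b - e‖)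
    (by positivity : 0 < ‖(e : Z)‖ ^ 2) (sub_pos.mpr hac)
  have hω : a + δ ∈ Set.Ioo a c := ⟨by linarith, by linarith⟩
  refine ⟨a + δ, hω, ?_⟩
  have hT := hA.isSelfAdjoint (hgap _ hω)
  unfold realGain
  rw [re_inner_eigenvector_split hT
    (realResolvent_apply_eigenvector (hgap _ hω) he hω.1.ne') hbe]
  have h1 := le_re_inner_of_le_spectrum hT
    (fun ν hν => (spectrum_realResolvent_bounds hgap hω hν).1) (b - e)
  have h2 : a + δ - a = δ := by ring
  have h3 : c - (a + δ) = c - a - δ := by ring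
  rw [h2]
  rw [h3] at h1
  linarith

theorem exists_realGain_neg (hA : IsSkewSymmetric A) {b : Z} {a c : ℝ} (hac : a < c)
    (hgap : ∀ ω ∈ Set.Ioo a c, (ω * Complex.I : ℂ) ∈ resolventSet A)
    {x : A.domain} (hx : A x = (c * Complex.I : ℂ) • (x : Z)) (hb : ⟪b, (x : Z)⟫_ℂ ≠ 0) :
    ∃ ω ∈ Set.Ioo a c, realGain A b ω < 0 := by
  obtain ⟨e, he, he0, hbe⟩ := exists_eigenvector_component hx hb
  obtain ⟨δ, hδ, hδl, hlt⟩ := exists_pole_dominates (sq_nonneg ‖b - e‖)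
    (by positivity : 0 < ‖(e : Z)‖ ^ 2) (sub_pos.mpr hac)
  have hω : c - δ ∈ Set.Ioo a c := ⟨by linarith, by linarith⟩
  refine ⟨c - δ, hω, ?_⟩
  have hT := hA.isSelfAdjoint (hgap _ hω)
  unfold realGain
  rw [re_inner_eigenvector_split hT
    (realResolvent_apply_eigenvector (hgap _ hω) he hω.2.ne) hbe]
  have h1 := re_inner_le_of_spectrum_le hT
    (fun ν hν => (spectrum_realResolvent_bounds hgap hω hν).2) (b - e)
  have h2 : c - δ - c = -δ := by ring
  have h3 : c - δ - a = c - a - δ := by ring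
  rw [h2, inv_neg]
  rw [h3] at h1
  linarith

theorem strictAntiOn_realGain (hA : IsSkewSymmetric A) {b : Z} (hb : b ≠ 0) {s : Set ℝ}
    (hs : Convex ℝ s) (hgap : ∀ ω ∈ s, (ω * Complex.I : ℂ) ∈ resolventSet A) :
    StrictAntiOn (realGain A b) s := by
  refine strictAntiOn_of_deriv_neg hs (fun ω hω =>
    (hasDerivAt_realGain hA b (hgap ω hω)).continuousAt.continuousWithinAt) (fun ω hω => ?_)
  have hω' := hgap ω (interior_subset hω)
  rw [(hasDerivAt_realGain hA b hω').deriv]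
  have := norm_pos_iff.mpr (realResolvent_apply_ne_zero hω' hb)
  simp only [neg_lt_zero]
  positivity

theorem existsUnique_realGain_zero (hA : IsSkewSymmetric A) {b : Z} {a c : ℝ} (hac : a < c)
    (hgap : ∀ ω ∈ Set.Ioo a c, (ω * Complex.I : ℂ) ∈ resolventSet A)
    {x y : A.domain} (hx : A x = (a * Complex.I : ℂ) • (x : Z)) (hbx : ⟪b, (x : Z)⟫_ℂ ≠ 0)
    (hy : A y = (c * Complex.I : ℂ) • (y : Z)) (hby : ⟪b, (y : Z)⟫_ℂ ≠ 0) :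
    ∃! ω, ω ∈ Set.Ioo a c ∧ realGain A b ω = 0 := by
  have hb : b ≠ 0 := by rintro rfl; exact hbx (inner_zero_left _)
  obtain ⟨p, hp, hp0⟩ := exists_realGain_pos hA hac hgap hx hbx
  obtain ⟨q, hq, hq0⟩ := exists_realGain_neg hA hac hgap hy hby
  have hcont : ContinuousOn (realGain A b) (Set.Ioo a c) := fun ω hω =>
    (hasDerivAt_realGain hA b (hgap ω hω)).continuousAt.continuousWithinAt
  obtain ⟨ω, hω, h0⟩ := isPreconnected_Ioo.intermediate_value hq hp hcont ⟨hq0.le, hp0.le⟩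
  refine ⟨ω, ⟨hω, h0⟩, fun τ hτ => ?_⟩
  exact (strictAntiOn_realGain hA hb (convex_Ioo a c) hgap).injOn hτ.1 hω (hτ.2.trans h0.symm)

/-- A zero of the gain has spectrum on both sides. -/
theorem exists_spectrum_lt_lt (hA : IsSkewSymmetric A) {b : Z} (hb : b ≠ 0) {ω : ℝ}
    (hω : (ω * Complex.I : ℂ) ∈ resolventSet A) (h0 : realGain A b ω = 0) :
    (∃ l : ℝ, (l * Complex.I : ℂ) ∈ spectrum A ∧ l < ω) ∧
      ∃ l : ℝ, (l * Complex.I : ℂ) ∈ spectrum A ∧ ω < l := by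
  constructor
  · by_contra! hcon
    -- Without spectrum below `ω`, all values `1 / (ω - l)` are negative, so `T ≤ 0` and a vanishing
    -- form would give `T b = 0`.
    refine realResolvent_apply_ne_zero hω hb
      (apply_eq_zero_of_spectrum_nonpos (hA.isSelfAdjoint hω) (fun ν hν => ?_) h0)
    by_contra! hpos
    have := hcon _ (mem_spectrum_of_mem_spectrum_realResolvent hω hν hpos.ne')
    have h2 := inv_pos.mpr hpos
    linarith
  · by_contra! hcon
    refine realResolvent_apply_ne_zero hω hb
      (apply_eq_zero_of_spectrum_nonneg (hA.isSelfAdjoint hω) (fun ν hν => ?_) h0)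
    by_contra! hneg
    have := hcon _ (mem_spectrum_of_mem_spectrum_realResolvent hω hν hneg.ne)
    have h2 := inv_lt_zero.mpr hneg
    linarith

end Gain

/-! ### Interlacing of gain zeros and spectrum. -/

section Interlacing

variable {Z : Type*} [NormedAddCommGroup Z] [InnerProductSpace ℂ Z] {A : Z →ₗ.[ℂ] Z}

/-- Infinitely many spectral points in `(l₁, l₂]` would accumulate by compactness, so a least one
exists. -/
theorem HasDiscreteSpectrum.exists_consecutive (h : HasDiscreteSpectrum A) {l₁ l₂ : ℝ}
    (h₁ : (l₁ * Complex.I : ℂ) ∈ spectrum A) (h₂ : (l₂ * Complex.I : ℂ) ∈ spectrum A)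
    (hlt : l₁ < l₂) :
    ∃ l, Consecutive {ω : ℝ | (ω * Complex.I : ℂ) ∈ spectrum A} l₁ l ∧ l ≤ l₂ := by
  have hfin : ({ω : ℝ | (ω * Complex.I : ℂ) ∈ spectrum A} ∩ Set.Ioc l₁ l₂).Finite := by
    by_contra hinf
    set φ : ℝ → ℂ := fun ω => ω * Complex.I with hφ
    have hφi : Function.Injective φ := fun x y hxy => by
      exact_mod_cast mul_right_cancel₀ Complex.I_ne_zero hxy
    have hφc : Continuous φ := by fun_prop
    have hinf' := (Set.Infinite.image (f := φ) hφi.injOn hinf)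
    obtain ⟨z, -, hz⟩ := hinf'.exists_accPt_of_subset_isCompact
      ((isCompact_Icc (a := l₁) (b := l₂)).image hφc)
      (Set.image_mono (Set.inter_subset_right.trans Set.Ioc_subset_Icc_self))
    refine h.noAccumulation z (hz.mono (Filter.principal_mono.mpr ?_))
    rintro _ ⟨ω, hω, rfl⟩
    exact hω.1
  obtain ⟨l, hl, hmin⟩ := Set.exists_min_image _ id hfin ⟨l₂, h₂, hlt, le_rfl⟩
  refine ⟨l, ⟨h₁, hl.1, hl.2.1, fun c hc hlc => ?_⟩, hl.2.2⟩
  exact absurd (hmin c ⟨hc, hlc.1, hlc.2.le.trans hl.2.2⟩) (not_le.mpr hlc.2)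

/-- No eigenvector of `A` is orthogonal to `b`. -/
def NoOrthogonalEigenvector (A : Z →ₗ.[ℂ] Z) (b : Z) : Prop :=
  ∀ (s : ℂ) (x : A.domain), A x = s • (x : Z) → ⟪b, (x : Z)⟫_ℂ = 0 → x = 0

theorem NoOrthogonalEigenvector.exists_eigenvector {b : Z} (h : NoOrthogonalEigenvector A b)
    (hspec : HasDiscreteSpectrum A) {s : ℂ} (hs : s ∈ spectrum A) :
    ∃ x : A.domain, A x = s • (x : Z) ∧ ⟪b, (x : Z)⟫_ℂ ≠ 0 := by
  obtain ⟨x, hx, hAx⟩ := hspec.isEigenvalue s hs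
  exact ⟨x, hAx, fun h0 => hx (h s x hAx h0)⟩

variable [CompleteSpace Z]

theorem interlaces_realGain_zeros (hA : IsSkewSymmetric A) (hspec : HasDiscreteSpectrum A)
    {b : Z} (hb : b ≠ 0) (hbe : NoOrthogonalEigenvector A b) :
    Interlaces {ω : ℝ | (ω * Complex.I : ℂ) ∈ resolventSet A ∧ realGain A b ω = 0}
      {ω : ℝ | (ω * Complex.I : ℂ) ∈ spectrum A} := by
  have left : ∀ a c : ℝ, Consecutive {ω : ℝ | (ω * Complex.I : ℂ) ∈ spectrum A} a c →
      ∃! ω, ω ∈ Set.Ioo a c ∧ realGain A b ω = 0 := by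
    rintro a c ⟨ha, hc, hac, hno⟩
    obtain ⟨x, hx, hbx⟩ := hbe.exists_eigenvector hspec ha
    obtain ⟨y, hy, hby⟩ := hbe.exists_eigenvector hspec hc
    exact existsUnique_realGain_zero hA hac
      (fun ω hω => by_contra fun hcon => hno ω hcon hω) hx hbx hy hby
  refine ⟨?_, ?_, ?_, ?_⟩
  · rw [Set.disjoint_left]
    exact fun ω hω hω' => hω' hω.1
  · rintro ω ⟨hω, h0⟩
    obtain ⟨⟨l, hl, hlt⟩, m, hm, hlt'⟩ := exists_spectrum_lt_lt hA hb hω h0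
    exact ⟨l, hl, m, hm, hlt, hlt'⟩
  · intro a c hac
    obtain ⟨ω, ⟨hω, h0⟩, huniq⟩ := left a c hac
    refine ⟨ω, ⟨⟨by_contra fun hcon => hac.2.2.2 ω hcon hω, h0⟩, hω⟩, ?_⟩
    rintro τ ⟨⟨-, hτ0⟩, hτ⟩
    exact huniq τ ⟨hτ, hτ0⟩
  · rintro a c ⟨⟨ha, ha0⟩, ⟨hc, hc0⟩, hac, hno⟩
    -- Otherwise the strictly decreasing gain would vanish at both ends of `[a, c]`.
    have hex : ∃ l : ℝ, (l * Complex.I : ℂ) ∈ spectrum A ∧ a < l ∧ l < c := by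
      by_contra! hcon
      have hgap : ∀ ω ∈ Set.Icc a c, (ω * Complex.I : ℂ) ∈ resolventSet A := by
        intro ω hω
        rcases hω.1.eq_or_lt with rfl | h1
        · exact ha
        rcases hω.2.eq_or_lt with rfl | h2
        · exact hc
        by_contra h3
        exact absurd (hcon ω h3 h1) (not_le.mpr h2)
      exact hac.ne ((strictAntiOn_realGain hA hb (convex_Icc a c) hgap).injOn
        (Set.left_mem_Icc.mpr hac.le) (Set.right_mem_Icc.mpr hac.le) (ha0.trans hc0.symm))
    -- Two spectral points between consecutive zeros would enclose a further zero.
    have huniq : ∀ l₁ l₂ : ℝ, (l₁ * Complex.I : ℂ) ∈ spectrum A →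
        (l₂ * Complex.I : ℂ) ∈ spectrum A → a < l₁ → l₂ < c → ¬ l₁ < l₂ := by
      intro l₁ l₂ h₁ h₂ hal hlc hlt
      obtain ⟨l, hcons, hle⟩ := hspec.exists_consecutive h₁ h₂ hlt
      obtain ⟨ω, ⟨hω, h0⟩, -⟩ := left l₁ l hcons
      exact hno ω ⟨by_contra fun hcon => hcons.2.2.2 ω hcon hω, h0⟩
        ⟨hal.trans hω.1, hω.2.trans_le (hle.trans hlc.le)⟩
    obtain ⟨l, hl, hal, hlc⟩ := hex
    refine ⟨l, ⟨hl, hal, hlc⟩, ?_⟩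
    rintro m ⟨hm, ham, hmc⟩
    exact le_antisymm (not_lt.mp (huniq l m hl hm hal hmc)) (not_lt.mp (huniq m l hm hl ham hlc))

end Interlacing

/-! ### Transmission and invariant zeros. -/

section Zeros

variable {Z : Type*} [NormedAddCommGroup Z] [InnerProductSpace ℂ Z]
  {A : Z →ₗ.[ℂ] Z} {B : ℂ →L[ℂ] Z}

theorem apply_eq_smul (B : ℂ →L[ℂ] Z) (u : ℂ) : B u = u • B 1 := by
  rw [← map_smul, smul_eq_mul, mul_one]

theorem apply_one_ne_zero (hB : B ≠ 0) : B 1 ≠ 0 := by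
  intro h
  apply hB
  ext
  simpa using h

theorem re_inner_resolvent (hA : IsSkewSymmetric A) {s : ℂ} {R : Z →L[ℂ] Z}
    (hR : IsResolventAt A s R) (b : Z) : (⟪b, R b⟫_ℂ).re = s.re * ‖R b‖ ^ 2 := by
  have h1 := hA.re_inner_shift s ⟨R b, hR.mem_domain b⟩
  rw [hR.shift_apply_self] at h1
  rw [← h1, ← inner_conj_symm, Complex.conj_re]

variable [CompleteSpace Z]

theorem adjoint_apply_eq_inner (B : ℂ →L[ℂ] Z) (x : Z) :
    ContinuousLinearMap.adjoint B x = ⟪B 1, x⟫_ℂ := by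
  rw [← ContinuousLinearMap.adjoint_inner_right]
  simp

/-- An eigenvector orthogonal to `b` exhibits its eigenvalue as an invariant zero with `u = 0`. -/
theorem IsMinimal.noOrthogonalEigenvector (h : IsMinimal A B (ContinuousLinearMap.adjoint B)) :
    NoOrthogonalEigenvector A (B 1) := by
  intro s x hx hbx
  by_contra h0
  have h1 : s ∈ invariantZeros A B (ContinuousLinearMap.adjoint B) ∩ spectrum A := by
    refine ⟨⟨x, 0, h0, ?_, ?_⟩, mem_spectrum_of_mem_eigenvalues ⟨x, h0, hx⟩⟩
    · rw [hx, map_zero, sub_self, sub_zero]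
    · rw [adjoint_apply_eq_inner, hbx]
  rw [h] at h1
  exact h1

theorem transferFunction_eq_inner (A : Z →ₗ.[ℂ] Z) (B : ℂ →L[ℂ] Z) (s : ℂ) :
    transferFunction A B (ContinuousLinearMap.adjoint B) s = ⟪B 1, resolvent A s (B 1)⟫_ℂ :=
  adjoint_apply_eq_inner B _

/-- `Re G(s) = Re s ‖R b‖²` with `R b ≠ 0`; on the axis `G` is purely imaginary and the gain is `-Im
G`. -/
theorem mem_transmissionZeros_iff (hA : IsSkewSymmetric A) (hB : B ≠ 0) {s : ℂ} :
    s ∈ transmissionZeros A B (ContinuousLinearMap.adjoint B) ↔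
      s.re = 0 ∧ s ∈ resolventSet A ∧ realGain A (B 1) s.im = 0 := by
  have hsI : s.re = 0 → (s.im * Complex.I : ℂ) = s := fun h => by
    apply Complex.ext <;> simp [h]
  have hgain : s.re = 0 → realGain A (B 1) s.im = -(⟪B 1, resolvent A s (B 1)⟫_ℂ).im := by
    intro h
    rw [realGain, realResolvent, hsI h, smul_apply, inner_smul_right, Complex.I_mul_re]
  unfold transmissionZeros
  rw [Set.mem_ofPred_eq, transferFunction_eq_inner]
  constructor
  · rintro ⟨hs, h0⟩
    have h1 := re_inner_resolvent hA (isResolventAt_resolvent hs) (B 1)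
    have h2 := (isResolventAt_resolvent hs).apply_ne_zero (apply_one_ne_zero hB)
    have hre : s.re = 0 := by
      rw [h0, Complex.zero_re] at h1
      simpa [h2] using h1.symm
    refine ⟨hre, hs, ?_⟩
    rw [hgain hre, h0, Complex.zero_im, neg_zero]
  · rintro ⟨hre, hs, h0⟩
    refine ⟨hs, Complex.ext ?_ ?_⟩
    · rw [re_inner_resolvent hA (isResolventAt_resolvent hs), hre, zero_mul, Complex.zero_re]
    · rw [hgain hre] at h0
      simpa using h0

/-- Off `σ(A)` the zero equation reads `x = u R b`, so `x ≠ 0` gives `u ≠ 0`, and `C x = u G(s)`. -/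
theorem IsMinimal.invariantZeros_eq (h : IsMinimal A B (ContinuousLinearMap.adjoint B))
    (hB : B ≠ 0) : invariantZeros A B (ContinuousLinearMap.adjoint B) =
      transmissionZeros A B (ContinuousLinearMap.adjoint B) := by
  ext s
  constructor
  · intro hs
    have hρ : s ∈ resolventSet A := by
      by_contra hcon
      have h1 : s ∈ invariantZeros A B (ContinuousLinearMap.adjoint B) ∩ spectrum A := ⟨hs, hcon⟩
      rw [h] at h1
      exact h1
    obtain ⟨x, u, hx, hxu, hCx⟩ := hs
    refine ⟨hρ, ?_⟩
    have hshift : shift A s x = u • B 1 := by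
      rw [← apply_eq_smul]; exact sub_eq_zero.mp hxu
    have h1 := (isResolventAt_resolvent hρ).eq_of_shift x hshift
    rw [map_smul] at h1
    have hu : u ≠ 0 := by
      rintro rfl
      rw [zero_smul] at h1
      exact hx (Subtype.ext h1.symm)
    rw [← h1, map_smul, smul_eq_mul] at hCx
    exact (mul_eq_zero.mp hCx).resolve_left hu
  · rintro ⟨hρ, h0⟩
    have hR := isResolventAt_resolvent hρ
    refine ⟨⟨_, hR.mem_domain (B 1)⟩, 1, ?_, ?_, h0⟩
    · intro h1
      exact hR.apply_ne_zero (apply_one_ne_zero hB) (congrArg Subtype.val h1)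
    · exact sub_eq_zero.mpr (hR.shift_apply_self (B 1))

theorem interlaces_transmissionZeros (hA : IsSkewSymmetric A) (hB : B ≠ 0)
    (hspec : HasDiscreteSpectrum A) (hbe : NoOrthogonalEigenvector A (B 1)) :
    InterlacesOnImaginaryAxis (transmissionZeros A B (ContinuousLinearMap.adjoint B))
      (eigenvalues A) := by
  have hsI : ∀ s : ℂ, s.re = 0 → (s.im * Complex.I : ℂ) = s := fun s h => by
    apply Complex.ext <;> simp [h]
  refine ⟨fun s hs => ((mem_transmissionZeros_iff hA hB).mp hs).1,
    fun s hs => hA.re_eq_zero hs, ?_⟩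
  convert interlaces_realGain_zeros hA hspec (apply_one_ne_zero hB) hbe using 1
  · ext ω
    constructor
    · rintro ⟨s, hs, rfl⟩
      obtain ⟨h1, h2, h3⟩ := (mem_transmissionZeros_iff hA hB).mp hs
      exact ⟨(hsI s h1).symm ▸ h2, h3⟩
    · rintro ⟨h1, h2⟩
      exact ⟨ω * Complex.I, (mem_transmissionZeros_iff hA hB).mpr ⟨by simp, h1, by simpa using h2⟩,
        by simp⟩
  · rw [hspec.eigenvalues_eq]
    ext ω
    constructor
    · rintro ⟨s, hs, rfl⟩
      have h1 : s.re = 0 := hA.re_eq_zero (hspec.isEigenvalue s hs)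
      change (s.im * Complex.I : ℂ) ∈ spectrum A
      rwa [hsI s h1]
    · intro h1
      exact ⟨ω * Complex.I, h1, by simp⟩

end Zeros

/-! ### Algebraic simplicity of eigenvalues. -/

section Multiplicity

variable {Z : Type*} [NormedAddCommGroup Z] [InnerProductSpace ℂ Z] {A : Z →ₗ.[ℂ] Z}

theorem mem_kerPow_succ {s : ℂ} {n : ℕ} {z : Z} :
    z ∈ kerPow A s (n + 1) ↔ ∃ x : A.domain, shift A s x ∈ kerPow A s n ∧ (x : Z) = z := Iff.rfl

theorem mem_kerPow_one {s : ℂ} {z : Z} :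
    z ∈ kerPow A s 1 ↔ ∃ x : A.domain, A x = s • (x : Z) ∧ (x : Z) = z := by
  rw [mem_kerPow_succ]
  refine exists_congr fun x => and_congr_left fun _ => ?_
  change shift A s x ∈ (⊥ : Submodule ℂ Z) ↔ _
  rw [Submodule.mem_bot, shift_apply, sub_eq_zero, eq_comm]

/-- If `(s - A) x` is in the kernel, it is orthogonal to itself, since range and kernel are
orthogonal. -/
theorem IsSkewSymmetric.kerPow_le (hA : IsSkewSymmetric A) {s : ℂ} (hs : s.re = 0) (n : ℕ) :
    kerPow A s n ≤ kerPow A s 1 := by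
  induction n with
  | zero => exact bot_le
  | succ n ih =>
    rintro _ ⟨x, hx, rfl⟩
    obtain ⟨e, he, hex⟩ := mem_kerPow_one.mp (ih hx)
    have h1 := hA.inner_shift_eq_zero hs x he
    rw [← hex, inner_self_eq_zero] at h1
    rw [mem_kerPow_one]
    rw [h1] at hex
    rw [shift_apply] at hex
    exact ⟨x, (sub_eq_zero.mp hex.symm).symm, rfl⟩

theorem IsSkewSymmetric.genEigenspace_eq (hA : IsSkewSymmetric A) {s : ℂ} (hs : s.re = 0) :
    genEigenspace A s = kerPow A s 1 :=
  le_antisymm (iSup_le fun n => hA.kerPow_le hs n) (le_iSup (kerPow A s) 1)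

theorem NoOrthogonalEigenvector.finrank_genEigenspace {b : Z} (h : NoOrthogonalEigenvector A b)
    (hA : IsSkewSymmetric A) {s : ℂ} (hs : s ∈ eigenvalues A) :
    Module.finrank ℂ (genEigenspace A s) = 1 := by
  rw [hA.genEigenspace_eq (hA.re_eq_zero hs)]
  obtain ⟨x, hx, hAx⟩ := hs
  have hbx : ⟪b, (x : Z)⟫_ℂ ≠ 0 := fun h0 => hx (h s x hAx h0)
  refine finrank_eq_one (⟨x, mem_kerPow_one.mpr ⟨x, hAx, rfl⟩⟩ : kerPow A s 1) ?_ ?_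
  · intro h0
    exact hx (Subtype.ext (congrArg (fun v : kerPow A s 1 => (v : Z)) h0))
  · rintro ⟨w, hw⟩
    obtain ⟨y, hAy, rfl⟩ := mem_kerPow_one.mp hw
    refine ⟨⟪b, (y : Z)⟫_ℂ / ⟪b, (x : Z)⟫_ℂ, Subtype.ext ?_⟩
    have h1 := h s (y - (⟪b, (y : Z)⟫_ℂ / ⟪b, (x : Z)⟫_ℂ) • x) (by
      rw [LinearPMap.map_sub, LinearPMap.map_smul, hAx, hAy, smul_comm, ← smul_sub]; rfl) (by
      change ⟪b, (y : Z) - (⟪b, (y : Z)⟫_ℂ / ⟪b, (x : Z)⟫_ℂ) • (x : Z)⟫_ℂ = 0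
      rw [inner_sub_right, inner_smul_right, div_mul_cancel₀ _ hbx, sub_self])
    exact (congrArg Subtype.val (sub_eq_zero.mp h1)).symm

end Multiplicity

/-! ### Kernel and range at an isolated eigenvalue. -/

section IsolatedEigenvalue

variable {Z : Type*} [NormedAddCommGroup Z] [InnerProductSpace ℂ Z]
  {A : Z →ₗ.[ℂ] Z}

/-- Transfers kernel and range of `τ - T`, `τ = 1 / (ω₀ - ω)`, to `iω - A`. -/
theorem shift_resolvent_eq {ω ω₀ : ℝ} (hω₀ : (ω₀ * Complex.I : ℂ) ∈ resolventSet A)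
    (hne : ω₀ ≠ ω) (w : Z) :
    shift A (ω * Complex.I) ⟨resolvent A (ω₀ * Complex.I) w,
        (isResolventAt_resolvent hω₀).mem_domain w⟩ =
      ((ω₀ : ℂ) - ω) • ((((ω₀ - ω)⁻¹ : ℝ) : ℂ) • w - realResolvent A ω₀ w) := by
  have h0 : (ω₀ : ℂ) - ω ≠ 0 := by rw [sub_ne_zero]; exact_mod_cast hne
  rw [(isResolventAt_resolvent hω₀).shift_eq, realResolvent, smul_apply, smul_sub, smul_smul,
    smul_smul]
  push_cast
  rw [mul_inv_cancel₀ h0]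
  module

variable [CompleteSpace Z]

/-- At an isolated spectral point of a self-adjoint operator, the continuous functional calculus
gives a reduced resolvent `S`. -/
theorem exists_reduced_resolvent {T : Z →L[ℂ] Z} (hT : IsSelfAdjoint T) {τ : ℝ}
    (hτ : ∀ᶠ ν in nhds τ, ν ∈ _root_.spectrum ℝ T → ν = τ) :
    ∃ S : Z →L[ℂ] Z, (algebraMap ℝ (Z →L[ℂ] Z) τ - T) * (algebraMap ℝ (Z →L[ℂ] Z) τ - T) * S =
      algebraMap ℝ (Z →L[ℂ] Z) τ - T := by
  have hD : cfc (fun t : ℝ => τ - t) T = algebraMap ℝ (Z →L[ℂ] Z) τ - T := by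
    rw [cfc_sub (fun _ : ℝ => τ) (fun t : ℝ => t) T, cfc_const τ T, cfc_id' ℝ T]
  -- The convention `0⁻¹ = 0` is harmless at `τ`, which is isolated from the rest of the spectrum.
  have hf : ContinuousOn (fun t : ℝ => (τ - t)⁻¹) (_root_.spectrum ℝ T) := by
    intro t _
    rcases eq_or_ne t τ with rfl | ht
    · have h1 : ∀ᶠ ν in nhdsWithin t (_root_.spectrum ℝ T), (t - ν)⁻¹ = (t - t)⁻¹ := by
        filter_upwards [nhdsWithin_le_nhds hτ, self_mem_nhdsWithin] with ν h1 h2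
        rw [h1 h2]
      exact continuousWithinAt_const.congr_of_eventuallyEq h1 rfl
    · have : τ - t ≠ 0 := sub_ne_zero.mpr ht.symm
      exact ContinuousAt.continuousWithinAt (by fun_prop (disch := assumption))
  refine ⟨cfc (fun t : ℝ => (τ - t)⁻¹) T, ?_⟩
  rw [← hD, ← cfc_mul (fun t : ℝ => τ - t) (fun t : ℝ => τ - t) T,
    ← cfc_mul (fun t : ℝ => (τ - t) * (τ - t)) (fun t : ℝ => (τ - t)⁻¹) T (by fun_prop) hf]
  congr 1
  funext t
  exact mul_self_mul_inv _

/-- At an imaginary spectral point `s`, the range of `s - A` and its kernel together span `Z`. -/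
theorem HasDiscreteSpectrum.exists_ker_add_range (h : HasDiscreteSpectrum A)
    (hA : IsSkewSymmetric A) (ω : ℝ) :
    ∃ Q : Z →L[ℂ] Z, ∀ z, (∃ y : A.domain, shift A (ω * Complex.I) y = z - Q z) ∧
      ∃ e : A.domain, A e = (ω * Complex.I : ℂ) • (e : Z) ∧ (e : Z) = Q z := by
  have hacc : ∀ᶠ s in nhdsWithin (ω * Complex.I : ℂ) {(ω * Complex.I : ℂ)}ᶜ, s ∉ spectrum A := by
    have := h.noAccumulation (ω * Complex.I)
    rwa [accPt_iff_frequently_nhdsNE, Filter.not_frequently] at this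
  have hinj : ∀ x y : ℝ, (x * Complex.I : ℂ) = y * Complex.I → x = y := fun x y hxy => by
    exact_mod_cast mul_right_cancel₀ Complex.I_ne_zero hxy
  obtain ⟨ω₀, hω₀, hne⟩ : ∃ ω₀ : ℝ, (ω₀ * Complex.I : ℂ) ∈ resolventSet A ∧ ω₀ ≠ ω := by
    have hc : Filter.Tendsto (fun t : ℝ => (t * Complex.I : ℂ)) (nhdsWithin ω {ω}ᶜ)
        (nhdsWithin (ω * Complex.I : ℂ) {(ω * Complex.I : ℂ)}ᶜ) := by
      refine tendsto_nhdsWithin_of_tendsto_nhds_of_eventually_within _ ?_ ?_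
      · exact ((by fun_prop : Continuous fun t : ℝ => (t * Complex.I : ℂ)).tendsto ω).mono_left
          nhdsWithin_le_nhds
      · filter_upwards [self_mem_nhdsWithin] with t ht heq
        exact ht (hinj _ _ heq)
    obtain ⟨t, ht, ht'⟩ := ((hc.eventually hacc).and self_mem_nhdsWithin).exists
    exact ⟨t, by simpa [spectrum] using ht, ht'⟩
  have hd : ω₀ - ω ≠ 0 := sub_ne_zero.mpr hne
  have hτ : (ω₀ - ω)⁻¹ ≠ 0 := inv_ne_zero hd
  have hiso : ∀ᶠ ν in nhds (ω₀ - ω)⁻¹, ν ∈ _root_.spectrum ℝ (realResolvent A ω₀) →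
      ν = (ω₀ - ω)⁻¹ := by
    have hc : Filter.Tendsto (fun ν : ℝ => (((ω₀ - ν⁻¹ : ℝ) : ℂ) * Complex.I))
        (nhds (ω₀ - ω)⁻¹) (nhds (ω * Complex.I)) := by
      have h1 : ContinuousAt (fun ν : ℝ => (((ω₀ - ν⁻¹ : ℝ) : ℂ) * Complex.I)) (ω₀ - ω)⁻¹ := by
        have : ContinuousAt (fun ν : ℝ => ω₀ - ν⁻¹) (ω₀ - ω)⁻¹ := by
          fun_prop (disch := assumption)
        exact (Complex.continuous_ofReal.continuousAt.comp this).mul continuousAt_const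
      have h2 := h1.tendsto
      rwa [inv_inv, sub_sub_cancel] at h2
    filter_upwards [hc.eventually (eventually_nhdsWithin_iff.mp hacc),
      isOpen_ne.mem_nhds hτ] with ν h1 h2 hν
    have h3 := mem_spectrum_of_mem_spectrum_realResolvent hω₀ hν h2
    by_contra hcon
    refine h1 (fun heq => hcon ?_) h3
    have h4 := hinj _ _ heq
    rw [← inv_inv ν]
    congr 1
    linarith
  obtain ⟨S, hS⟩ := exists_reduced_resolvent (hA.isSelfAdjoint hω₀) hiso
  have happ : ∀ w, (algebraMap ℝ (Z →L[ℂ] Z) (ω₀ - ω)⁻¹ - realResolvent A ω₀) w =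
      (((ω₀ - ω)⁻¹ : ℝ) : ℂ) • w - realResolvent A ω₀ w := fun w => by
    rw [Algebra.algebraMap_eq_smul_one]; rfl
  set D := algebraMap ℝ (Z →L[ℂ] Z) (ω₀ - ω)⁻¹ - realResolvent A ω₀ with hDdef
  have hdc : (ω₀ : ℂ) - ω ≠ 0 := by exact_mod_cast hd
  have hshift := shift_resolvent_eq hω₀ hne
  -- `D² S = D` gives `D (1 - D S) = 0`, so `1 - D S` maps into the kernel of `D`, while its
  -- complement `D S` maps into the range.
  refine ⟨1 - D * S, fun z => ⟨⟨((ω₀ : ℂ) - ω)⁻¹ • ⟨resolvent A (ω₀ * Complex.I) (S z),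
    (isResolventAt_resolvent hω₀).mem_domain _⟩, ?_⟩, ?_⟩⟩
  · rw [map_smul, hshift, ← happ, smul_smul, inv_mul_cancel₀ hdc, one_smul]
    simp
  · set q := (1 - D * S) z with hq
    have hDq : D q = 0 := by
      have h1 : D * (1 - D * S) = 0 := by rw [mul_sub, mul_one, ← mul_assoc, hS, sub_self]
      exact congrArg (fun F : Z →L[ℂ] Z => F z) h1
    have h1 := hshift q
    rw [← happ, hDq, smul_zero] at h1
    rw [happ, sub_eq_zero, realResolvent, smul_apply] at hDq
    set r : A.domain := ⟨resolvent A (ω₀ * Complex.I) q,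
      (isResolventAt_resolvent hω₀).mem_domain q⟩ with hr
    have hqr : q = (((ω₀ : ℂ) - ω) * Complex.I) • (r : Z) := by
      have h2 : ((ω₀ : ℂ) - ω) • ((((ω₀ - ω)⁻¹ : ℝ) : ℂ) • q) = q := by
        push_cast
        rw [smul_smul, mul_inv_cancel₀ hdc, one_smul]
      rw [← h2, hDq, smul_smul]
    refine ⟨(((ω₀ : ℂ) - ω) * Complex.I) • r, ?_, hqr.symm⟩
    rw [shift_apply, sub_eq_zero] at h1
    rw [LinearPMap.map_smul, ← h1, smul_comm]
    rfl

end IsolatedEigenvalue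

/-! ### Closed-loop spectrum. -/

section ClosedLoop

variable {Z : Type*} [NormedAddCommGroup Z] [InnerProductSpace ℂ Z]
  {A : Z →ₗ.[ℂ] Z} {B : ℂ →L[ℂ] Z}

/-- Pairing with `x` gives `Re s ‖x‖² + k |⟨b, x⟩|² = 0`, so `x` solves the eigenvalue equation and
is orthogonal to `b`. -/
theorem eq_zero_of_closedLoop_eq_zero (hA : IsSkewSymmetric A) {b : Z}
    (hbe : NoOrthogonalEigenvector A b) {k : ℝ} (hk : 0 < k) {s : ℂ} (hs : 0 ≤ s.re)
    {x : A.domain} (hx : shift A s x + ((k : ℂ) * ⟪b, (x : Z)⟫_ℂ) • b = 0) : x = 0 := by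
  have h1 := congrArg (fun z => (⟪(x : Z), z⟫_ℂ).re) hx
  simp only [inner_add_right, Complex.add_re, inner_zero_right, Complex.zero_re,
    inner_smul_right] at h1
  have h2 : (((k : ℂ) * ⟪b, (x : Z)⟫_ℂ * ⟪(x : Z), b⟫_ℂ)).re = k * ‖⟪b, (x : Z)⟫_ℂ‖ ^ 2 := by
    rw [← inner_conj_symm (x : Z) b, mul_assoc, Complex.mul_conj, Complex.normSq_eq_norm_sq]
    norm_cast
  rw [h2, hA.re_inner_shift] at h1
  have h3 : 0 ≤ s.re * ‖(x : Z)‖ ^ 2 := by positivity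
  have h4 : 0 ≤ k * ‖⟪b, (x : Z)⟫_ℂ‖ ^ 2 := by positivity
  have h5 : k * ‖⟪b, (x : Z)⟫_ℂ‖ ^ 2 = 0 := by linarith
  have h6 : ⟪b, (x : Z)⟫_ℂ = 0 := by simpa [hk.ne'] using h5
  rw [h6, mul_zero, zero_smul, add_zero, shift_apply, sub_eq_zero] at hx
  exact hbe s x hx.symm h6

/-- Sherman–Morrison: the denominator `1 + k ⟨b, R b⟩` has real part at least `1`. -/
theorem exists_closedLoop_eq_of_mem_resolventSet (hA : IsSkewSymmetric A) (b : Z) {k : ℝ}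
    (hk : 0 < k) {s : ℂ} (hs : 0 ≤ s.re) (hρ : s ∈ resolventSet A) (z : Z) :
    ∃ x : A.domain, shift A s x + ((k : ℂ) * ⟪b, (x : Z)⟫_ℂ) • b = z := by
  obtain ⟨R, hR⟩ := hρ
  have h1 : (1 : ℂ) + k * ⟪b, R b⟫_ℂ ≠ 0 := by
    intro h0
    have h2 := congrArg Complex.re h0
    rw [Complex.add_re, Complex.re_ofReal_mul, re_inner_resolvent hA hR, Complex.one_re,
      Complex.zero_re] at h2
    have : 0 ≤ k * (s.re * ‖R b‖ ^ 2) := by positivity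
    linarith
  obtain ⟨γ, hγ⟩ : ∃ γ, γ * (1 + k * ⟪b, R b⟫_ℂ) = k * ⟪b, R z⟫_ℂ := ⟨_, div_mul_cancel₀ _ h1⟩
  refine ⟨⟨R z, hR.mem_domain z⟩ - γ • ⟨R b, hR.mem_domain b⟩, ?_⟩
  rw [map_sub, map_smul, hR.shift_apply_self, hR.shift_apply_self]
  change z - γ • b + ((k : ℂ) * ⟪b, R z - γ • R b⟫_ℂ) • b = z
  have h3 : (k : ℂ) * ⟪b, R z - γ • R b⟫_ℂ = γ := by
    rw [inner_sub_right, inner_smul_right]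
    linear_combination -hγ
  rw [h3, sub_add_cancel]

variable [CompleteSpace Z]

/-- By the open mapping theorem, `s` is in the resolvent set of the closed loop as soon as
`s - (A - k B C)` is bijective. -/
theorem mem_resolventSet_closedLoop {C : Z →L[ℂ] ℂ} {k : ℝ} {s μ : ℂ} {R : Z →L[ℂ] Z}
    (hR : IsResolventAt A μ R)
    (hinj : ∀ x : A.domain, shift A s x + ((k : ℂ) * C (x : Z)) • B 1 = 0 → x = 0)
    (hsurj : ∀ z, ∃ x : A.domain, shift A s x + ((k : ℂ) * C (x : Z)) • B 1 = z) :
    s ∈ resolventSet (closedLoop A B C k) := by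
  -- `Φ` is the closed-loop `s - (A - kBC)` composed with `R`, hence bounded and everywhere defined.
  let Φ : Z →L[ℂ] Z := 1 + (s - μ) • R + ((k : ℂ) • (C ∘L R)).smulRight (B 1)
  have hΦ : ∀ v, Φ v = shift A s ⟨R v, hR.mem_domain v⟩ + ((k : ℂ) * C (R v)) • B 1 := by
    intro v
    rw [hR.shift_eq]
    rfl
  have hΦx : ∀ x : A.domain, Φ (shift A μ x) = shift A s x + ((k : ℂ) * C (x : Z)) • B 1 := by
    intro x
    have h1 : (⟨R (shift A μ x), hR.mem_domain _⟩ : A.domain) = x := Subtype.ext (hR.2 x)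
    rw [hΦ, h1, hR.2]
  have hker : Φ.ker = ⊥ := by
    rw [LinearMap.ker_eq_bot']
    intro v hv
    have h1 := hinj _ ((hΦ v).symm.trans hv)
    have h2 := hR.shift_apply_self v
    rwa [h1, map_zero, eq_comm] at h2
  have hrange : Φ.range = ⊤ := by
    rw [LinearMap.range_eq_top]
    intro z
    obtain ⟨x, hx⟩ := hsurj z
    exact ⟨shift A μ x, (hΦx x).trans hx⟩
  let E := ContinuousLinearEquiv.ofBijective Φ hker hrange
  have hE : ∀ v, E v = Φ v := fun v => rfl
  refine ⟨R ∘L (E.symm : Z →L[ℂ] Z), fun z => ⟨hR.mem_domain (E.symm z), ?_⟩, fun x => ?_⟩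
  · refine (shift_closedLoop_apply (A := A) B C k s ⟨R (E.symm z), hR.mem_domain _⟩).trans ?_
    exact (hΦ (E.symm z)).symm.trans (E.apply_symm_apply z)
  · have h1 : shift (closedLoop A B C k) s x = E (shift A μ x) :=
      (shift_closedLoop_apply (A := A) B C k s x).trans (hΦx x).symm
    rw [h1]
    exact (congrArg R (E.symm_apply_apply _)).trans (hR.2 x)

/-- Decompose `b = (s - A) yb + eb` and `z = (s - A) y + e` with `e = u eb` in the one-dimensional
kernel. Then `y - u yb + γ eb` is mapped by `s - A` to `z - u b`, and `γ` is tuned so that the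
feedback term equals `u b`. -/
theorem exists_closedLoop_eq_of_mem_spectrum (hA : IsSkewSymmetric A)
    (hspec : HasDiscreteSpectrum A) {b : Z} (hbe : NoOrthogonalEigenvector A b) {k : ℝ}
    (hk : 0 < k) {s : ℂ} (hσ : s ∈ spectrum A) (z : Z) :
    ∃ x : A.domain, shift A s x + ((k : ℂ) * ⟪b, (x : Z)⟫_ℂ) • b = z := by
  have hre : s.re = 0 := hA.re_eq_zero (hspec.isEigenvalue s hσ)
  obtain ⟨ω, rfl⟩ : ∃ ω : ℝ, s = ω * Complex.I :=
    ⟨s.im, by apply Complex.ext <;> simp [hre]⟩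
  have hk' : (k : ℂ) ≠ 0 := by exact_mod_cast hk.ne'
  obtain ⟨Q, hQ⟩ := hspec.exists_ker_add_range hA ω
  obtain ⟨⟨yb, hyb⟩, eb, heb, hebQ⟩ := hQ b
  obtain ⟨⟨y, hy⟩, e, he, heQ⟩ := hQ z
  -- Otherwise `eb = 0`, so `b` is in the range and hence orthogonal to an eigenvector.
  have hbeb : ⟪b, (eb : Z)⟫_ℂ ≠ 0 := by
    intro h0
    have h1 : eb = 0 := hbe _ eb heb h0
    obtain ⟨x, hx, hbx⟩ := hbe.exists_eigenvector hspec hσ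
    have h2 := hA.inner_shift_eq_zero hre yb hx
    rw [hyb, ← hebQ, h1, ZeroMemClass.coe_zero, sub_zero] at h2
    exact hbx (by rw [← inner_conj_symm, h2, map_zero])
  set u := ⟪b, (e : Z)⟫_ℂ / ⟪b, (eb : Z)⟫_ℂ with hu
  have heu : (e : Z) = u • (eb : Z) := by
    have h1 := hbe (ω * Complex.I) (e - u • eb) (by
      rw [LinearPMap.map_sub, LinearPMap.map_smul, he, heb, smul_comm, ← smul_sub]; rfl) (by
      change ⟪b, (e : Z) - u • (eb : Z)⟫_ℂ = 0
      rw [inner_sub_right, inner_smul_right, hu, div_mul_cancel₀ _ hbeb, sub_self])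
    exact congrArg Subtype.val (sub_eq_zero.mp h1)
  set γ := (u / k - ⟪b, (y : Z) - u • (yb : Z)⟫_ℂ) / ⟪b, (eb : Z)⟫_ℂ with hγ
  refine ⟨y - u • yb + γ • eb, ?_⟩
  have h1 : shift A (ω * Complex.I) eb = 0 := by rw [shift_apply, heb, sub_self]
  rw [map_add, map_sub, map_smul, map_smul, h1, hy, hyb, ← hebQ, ← heQ, heu]
  change _ + ((k : ℂ) * ⟪b, (y : Z) - u • (yb : Z) + γ • (eb : Z)⟫_ℂ) • b = z
  have h2 : (k : ℂ) * ⟪b, (y : Z) - u • (yb : Z) + γ • (eb : Z)⟫_ℂ = u := by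
    rw [inner_add_right, inner_smul_right, hγ, div_mul_cancel₀ _ hbeb, add_sub_cancel,
      mul_div_cancel₀ _ hk']
  rw [h2]
  module

theorem re_neg_of_mem_spectrum_closedLoop (hA : IsSkewSymmetric A)
    (hspec : HasDiscreteSpectrum A) (hbe : NoOrthogonalEigenvector A (B 1)) {k : ℝ} (hk : 0 < k)
    {s : ℂ} (hs : s ∈ spectrum (closedLoop A B (ContinuousLinearMap.adjoint B) k)) :
    s.re < 0 := by
  by_contra! hre
  obtain ⟨R, hR⟩ : (1 : ℂ) ∈ resolventSet A := by
    by_contra hcon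
    exact absurd (hA.re_eq_zero (hspec.isEigenvalue 1 hcon)) (by simp)
  refine hs (mem_resolventSet_closedLoop hR (fun x hx => ?_) (fun z => ?_))
  · rw [adjoint_apply_eq_inner] at hx
    exact eq_zero_of_closedLoop_eq_zero hA hbe hk hre hx
  · simp only [adjoint_apply_eq_inner]
    by_cases hρ : s ∈ resolventSet A
    · exact exists_closedLoop_eq_of_mem_resolventSet hA _ hk hre hρ z
    · exact exists_closedLoop_eq_of_mem_spectrum hA hspec hbe hk hρ z

end ClosedLoop

end RootLocus

theorem mainTheorem3 {Z : Type*} [NormedAddCommGroup Z] [InnerProductSpace ℂ Z] [CompleteSpace Z]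
    (A : Z →ₗ.[ℂ] Z) (B : ℂ →L[ℂ] Z) (hB : B ≠ 0)
    (hspec : RootLocus.HasDiscreteSpectrum A)
    (hskew : RootLocus.IsSkewAdjoint A)
    (hmin : RootLocus.IsMinimal A B (ContinuousLinearMap.adjoint B)) :
    RootLocus.InterlacesOnImaginaryAxis
        (RootLocus.invariantZeros A B (ContinuousLinearMap.adjoint B)) (RootLocus.eigenvalues A) ∧
      RootLocus.InterlacesOnImaginaryAxis
        (RootLocus.transmissionZeros A B (ContinuousLinearMap.adjoint B))
        (RootLocus.eigenvalues A) ∧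
      (∀ s ∈ RootLocus.eigenvalues A, Module.finrank ℂ (RootLocus.genEigenspace A s) = 1) ∧
      (∀ f : ℝ → ℂ, RootLocus.IsRootLocusBranch A B (ContinuousLinearMap.adjoint B) f →
        ∀ k : ℝ, 0 ≤ k → (f k).re ≤ 0) ∧
      (∀ k : ℝ, 0 < k →
        ∀ s ∈ RootLocus.spectrum
          (RootLocus.closedLoop A B (ContinuousLinearMap.adjoint B) k), s.re < 0) := by
  have hA := hskew.isSkewSymmetric
  have hbe := hmin.noOrthogonalEigenvector
  have hint := RootLocus.interlaces_transmissionZeros hA hB hspec hbe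
  refine ⟨hmin.invariantZeros_eq hB ▸ hint, hint,
    fun s hs => hbe.finrank_genEigenspace hA hs, fun f hf k hk => ?_,
    fun k hk s hs => RootLocus.re_neg_of_mem_spectrum_closedLoop hA hspec hbe hk hs⟩
  rcases hk.eq_or_lt with rfl | hk
  · exact (hA.re_eq_zero (hspec.isEigenvalue _ hf.start)).le
  · exact (RootLocus.re_neg_of_mem_spectrum_closedLoop hA hspec hbe hk (hf.mem k hk.le)).le
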